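/- Let $q=3^r$ with $r\ge 1$. For $n\ge1$ let $$J=\begin{bmatrix}0&1_n&0\\1_n&0&0\\0&0&1\end{bmatrix},\qquad O(2n+1,q)=\{w\in GL(2n+1,q)\mid {}^twJw=J\},$$ and let $Q=Q(2n+1,q)$ be the subgroup of $O(2n+1,q)$ consisting of all products $$\begin{bmatrix}A&0&0\\0&{}^tA^{-1}&0\\0&0&1\end{bmatrix}\begin{bmatrix}1_n&B&-{}^th\\0&1_n&0\\0&h&1\end{bmatrix}$$ with $A\in GL(n,q)$, $B\in\mathbb F_q^{n\times n}$, $h\in\mathbb F_q^{1\times n}$ and $B+{}^tB+{}^thh=0$. Let $\rho=\mathrm{diag}(1_n,1_n,-1)$ and, for $0\le k\le n$, let $$\sigma_k=\begin{bmatrix}0&0&1_k&0&0\\0&1_{n-k}&0&0&0\\1_k&0&0&0&0\\0&0&0&1_{n-k}&0\\0&0&0&0&1\end{bmatrix}\in O(2n+1,q).$$ For odd $n\ge1$ put $DC_1^-(n,q)=Q\sigma_{n-1}Q$ and $DC_2^-(n,q)=\rho Q\sigma_{n-1}Q$; for even $n\ge2$ put $DC_1^+(n,q)=Q\sigma_{n-2}Q$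 and $DC_2^+(n,q)=\rho Q\sigma_{n-2}Q$. For a subset $S\subseteq O(2n+1,q)$ and $\beta\in\mathbb F_q$ let $N_S(\beta)=|\{w\in S\mid \mathrm{Tr}\,w=\beta\}|$. Then: 1. For each odd $n\ge3$, $N_{DC_1^-(n,q)}(\beta)>0$ for all $\beta\in\mathbb F_q$; and for $n=1$ and all $\beta\in\mathbb F_q$, $$N_{DC_1^-(1,q)}(\beta)=\begin{cases}2q,&\text{if }\beta^2-2\beta\ne0\text{ is a square in }\mathbb F_q,\\ q,&\text{if }\beta=0\text{ or }2,\\ 0,&\text{if }\beta^2-2\beta\text{ is a nonsquare}.\end{cases}$$ 2. For each odd $n\ge3$, $N_{DC_2^-(n,q)}(\beta)>0$ for all $\beta\in\mathbb F_q$; and for $n=1$ and all $\beta\in\mathbb F_q$, $$N_{DC_2^-(1,q)}(\beta)=\begin{cases}2q,&\text{if }\beta^2+2\beta\ne0\text{ is a square in }\mathbb F_q,\\ q,&\text{if }\beta=0\text{ or }1,\\ 0,&\text{if }\beta^2+2\beta\text{ is a nonsquare}.\end{cases}$$ 3. For each even $n\ge2$, $N_{DC_1^+(n,q)}(\beta)>0$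 for all $\beta\in\mathbb F_q$. 4. For each even $n\ge2$, $N_{DC_2^+(n,q)}(\beta)>0$ for all $\beta\in\mathbb F_q$. -/

import Mathlib

namespace OddOrthogonal

open Matrix

/-- Index set of size `2n+1`, split into blocks of sizes `n`, `n`, `1`. -/
abbrev Idx (n : ℕ) : Type := (Fin n ⊕ Fin n) ⊕ Fin 1

set_option linter.unusedSectionVars false

section Blocks

variable {F : Type*} [Field F] {n : ℕ}

/-- The `(2n+1) × (2n+1)` matrix with rows of blocks `A B e`, `C D f`, `g h i`. -/
def block3 (A B : Matrix (Fin n) (Fin n) F) (e : Matrix (Fin n) (Fin 1) F)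
    (C D : Matrix (Fin n) (Fin n) F) (f : Matrix (Fin n) (Fin 1) F)
    (g h : Matrix (Fin 1) (Fin n) F) (i : Matrix (Fin 1) (Fin 1) F) :
    Matrix (Idx n) (Idx n) F :=
  fromBlocks (fromBlocks A B C D) (fromRows e f) (fromCols g h) i

theorem block3_mul (A B : Matrix (Fin n) (Fin n) F) (e : Matrix (Fin n) (Fin 1) F)
    (C D : Matrix (Fin n) (Fin n) F) (f : Matrix (Fin n) (Fin 1) F)
    (g h : Matrix (Fin 1) (Fin n) F) (i : Matrix (Fin 1) (Fin 1) F)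
    (A' B' : Matrix (Fin n) (Fin n) F) (e' : Matrix (Fin n) (Fin 1) F)
    (C' D' : Matrix (Fin n) (Fin n) F) (f' : Matrix (Fin n) (Fin 1) F)
    (g' h' : Matrix (Fin 1) (Fin n) F) (i' : Matrix (Fin 1) (Fin 1) F) :
    block3 A B e C D f g h i * block3 A' B' e' C' D' f' g' h' i' =
      block3 (A * A' + B * C' + e * g') (A * B' + B * D' + e * h') (A * e' + B * f' + e * i')
        (C * A' + D * C' + f * g') (C * B' + D * D' + f * h') (C * e' + D * f' + f * i')
        (g * A' + h * C' + i * g') (g * B' + h * D' + i * h') (g * e' + h * f' + i * i') := by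
  ext x y
  rcases x with (x | x) | x <;> rcases y with (y | y) | y <;>
    simp [block3, Matrix.mul_apply, Fintype.sum_sum_type]

theorem block3_one : block3 (1 : Matrix (Fin n) (Fin n) F) 0 0 0 1 0 0 0 1 = 1 := by
  ext x y
  rcases x with (x | x) | x <;> rcases y with (y | y) | y <;>
    simp [block3, Matrix.one_apply]

theorem block3_transpose (A B : Matrix (Fin n) (Fin n) F) (e : Matrix (Fin n) (Fin 1) F)
    (C D : Matrix (Fin n) (Fin n) F) (f : Matrix (Fin n) (Fin 1) F)
    (g h : Matrix (Fin 1) (Fin n) F) (i : Matrix (Fin 1) (Fin 1) F) :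
    (block3 A B e C D f g h i)ᵀ = block3 Aᵀ Cᵀ gᵀ Bᵀ Dᵀ hᵀ eᵀ fᵀ iᵀ := by
  ext x y
  rcases x with (x | x) | x <;> rcases y with (y | y) | y <;> simp [block3]

end Blocks

variable (n : ℕ) (F : Type*) [Field F]

/-- The symmetric matrix `J` with blocks `0 1 0`, `1 0 0`, `0 0 1`. -/
def J : Matrix (Idx n) (Idx n) F := block3 0 1 0 1 0 0 0 0 1

/-- The orthogonal group `O(2n+1, F) = {w ∈ GL(2n+1, F) | ᵗw J w = J}`. -/
def O : Subgroup (GL (Idx n) F) where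
  carrier := {w | (w : Matrix (Idx n) (Idx n) F)ᵀ * J n F * (w : Matrix (Idx n) (Idx n) F) = J n F}
  mul_mem' {a b} ha hb := by
    simp only [Set.mem_ofPred_eq] at ha hb ⊢
    calc _ = (b : Matrix (Idx n) (Idx n) F)ᵀ *
          ((a : Matrix (Idx n) (Idx n) F)ᵀ * J n F * (a : Matrix (Idx n) (Idx n) F)) *
          (b : Matrix (Idx n) (Idx n) F) := by
            simp only [Units.val_mul, transpose_mul, Matrix.mul_assoc]
      _ = _ := by rw [ha, hb]
  one_mem' := by simp
  inv_mem' {a} ha := by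
    simp only [Set.mem_ofPred_eq] at ha ⊢
    have h1 : (a : Matrix (Idx n) (Idx n) F) * (a⁻¹ : GL (Idx n) F) = 1 := by simp
    have h2 : ((a⁻¹ : GL (Idx n) F) : Matrix (Idx n) (Idx n) F)ᵀ *
        (a : Matrix (Idx n) (Idx n) F)ᵀ = 1 := by
      rw [← transpose_mul, h1, transpose_one]
    calc _ = ((a⁻¹ : GL (Idx n) F) : Matrix (Idx n) (Idx n) F)ᵀ *
          ((a : Matrix (Idx n) (Idx n) F)ᵀ * J n F * (a : Matrix (Idx n) (Idx n) F)) *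
          ((a⁻¹ : GL (Idx n) F) : Matrix (Idx n) (Idx n) F) := by rw [ha]
      _ = (((a⁻¹ : GL (Idx n) F) : Matrix (Idx n) (Idx n) F)ᵀ *
          (a : Matrix (Idx n) (Idx n) F)ᵀ) * J n F * ((a : Matrix (Idx n) (Idx n) F) *
          ((a⁻¹ : GL (Idx n) F) : Matrix (Idx n) (Idx n) F)) := by
            simp only [Matrix.mul_assoc]
      _ = _ := by rw [h1, h2, Matrix.one_mul, Matrix.mul_one]

variable {n F}

/-- The underlying matrix of an element of `O(2n+1, F)`. -/
def mat (w : O n F) : Matrix (Idx n) (Idx n) F := ((w : GL (Idx n) F) : Matrix (Idx n) (Idx n) F)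

theorem mat_injective : Function.Injective (mat : O n F → Matrix (Idx n) (Idx n) F) :=
  fun _ _ h => Subtype.ext (Units.ext h)

theorem mat_mul (v w : O n F) : mat (v * w) = mat v * mat w := rfl

/-- The element `diag(A, ᵗA⁻¹, 1)`, for `A ∈ GL(n, F)`, as a matrix. -/
def levi (A : GL (Fin n) F) : Matrix (Idx n) (Idx n) F :=
  block3 (A : Matrix (Fin n) (Fin n) F) 0 0
    0 ((A⁻¹ : GL (Fin n) F) : Matrix (Fin n) (Fin n) F)ᵀ 0
    0 0 1

/-- The matrix with rows of blocks `1 B -ᵗh`, `0 1 0`, `0 h 1`. -/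
def unip (B : Matrix (Fin n) (Fin n) F) (h : Matrix (Fin 1) (Fin n) F) :
    Matrix (Idx n) (Idx n) F :=
  block3 1 B (-hᵀ) 0 1 0 0 h 1

theorem unip_mul_levi (A : GL (Fin n) F) (B : Matrix (Fin n) (Fin n) F)
    (h : Matrix (Fin 1) (Fin n) F) :
    unip B h * levi A =
      levi A * unip (((A⁻¹ : GL (Fin n) F) : Matrix (Fin n) (Fin n) F) * B *
        ((A⁻¹ : GL (Fin n) F) : Matrix (Fin n) (Fin n) F)ᵀ)
        (h * ((A⁻¹ : GL (Fin n) F) : Matrix (Fin n) (Fin n) F)ᵀ) := by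
  have h1 : (A : Matrix (Fin n) (Fin n) F) * (A⁻¹ : GL (Fin n) F) = 1 := by simp
  rw [unip, unip, levi, block3_mul, block3_mul]
  congr 1 <;> simp [-coe_units_inv, ← Matrix.mul_assoc, h1]

theorem levi_mul (A A' : GL (Fin n) F) : levi A * levi A' = levi (A * A') := by
  rw [levi, levi, levi, block3_mul]
  congr 1 <;> simp [-coe_units_inv, _root_.mul_inv_rev]

theorem unip_mul (B B' : Matrix (Fin n) (Fin n) F) (h h' : Matrix (Fin 1) (Fin n) F) :
    unip B h * unip B' h' = unip (B' + B - hᵀ * h') (h + h') := by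
  rw [unip, unip, unip, block3_mul]
  congr 1 <;> simp [sub_eq_add_neg, add_comm]

variable (n F)

/-- The subgroup `Q(2n+1, F)` of `O(2n+1, F)`: all products
`diag(A, ᵗA⁻¹, 1) * (1 B -ᵗh; 0 1 0; 0 h 1)` with `A ∈ GL(n, F)` and `B + ᵗB + ᵗh h = 0`. -/
def Q : Subgroup (O n F) where
  carrier := {w | ∃ (A : GL (Fin n) F) (B : Matrix (Fin n) (Fin n) F)
    (h : Matrix (Fin 1) (Fin n) F), B + Bᵀ + hᵀ * h = 0 ∧ mat w = levi A * unip B h}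
  mul_mem' := by
    rintro v w ⟨A, B, h, hB, hv⟩ ⟨A', B', h', hB', hw⟩
    set X := ((A'⁻¹ : GL (Fin n) F) : Matrix (Fin n) (Fin n) F) with hX
    refine ⟨A * A', B' + X * B * Xᵀ - (h * Xᵀ)ᵀ * h', h * Xᵀ + h', ?_, ?_⟩
    · have e : (B' + X * B * Xᵀ - (h * Xᵀ)ᵀ * h') + (B' + X * B * Xᵀ - (h * Xᵀ)ᵀ * h')ᵀ +
          (h * Xᵀ + h')ᵀ * (h * Xᵀ + h') =
          X * (B + Bᵀ + hᵀ * h) * Xᵀ + (B' + B'ᵀ + h'ᵀ * h') := by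
        simp only [transpose_add, transpose_sub, transpose_mul, transpose_transpose,
          Matrix.mul_add, Matrix.add_mul, Matrix.mul_assoc]
        abel
      rw [e, hB, hB']; simp
    · rw [mat_mul, hv, hw, ← levi_mul, Matrix.mul_assoc, ← Matrix.mul_assoc (unip B h),
        unip_mul_levi, Matrix.mul_assoc, unip_mul, ← Matrix.mul_assoc]
  one_mem' := by
    refine ⟨1, 0, 0, by simp, ?_⟩
    have : mat (1 : O n F) = 1 := rfl
    rw [this, levi, unip, block3_mul, ← block3_one]
    congr 1 <;> simp
  inv_mem' := by
    rintro w ⟨A, B, h, hB, hw⟩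
    set X := (A : Matrix (Fin n) (Fin n) F) with hX
    have hB2 : B + Bᵀ + hᵀ * h = 0 := hB
    have main : mat w⁻¹ = levi A⁻¹ * unip (X * Bᵀ * Xᵀ) (-h * Xᵀ) := by
      have h1 : mat w * (levi A⁻¹ * unip (X * Bᵀ * Xᵀ) (-h * Xᵀ)) = 1 := by
        have h2 := unip_mul_levi A⁻¹ Bᵀ (-h)
        rw [inv_inv] at h2
        rw [← h2, hw, Matrix.mul_assoc, ← Matrix.mul_assoc (unip B h), unip_mul]
        have h3 : Bᵀ + B - hᵀ * -h = 0 := by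
          rw [← hB2, Matrix.mul_neg, sub_neg_eq_add, add_comm Bᵀ B]
        have h4 : unip (0 : Matrix (Fin n) (Fin n) F) 0 = 1 := by
          rw [unip, ← block3_one]; simp
        rw [h3, add_neg_cancel, h4, Matrix.one_mul, levi_mul, mul_inv_cancel, levi,
          ← block3_one]
        simp
      have h5 : mat w⁻¹ * mat w = 1 := by
        rw [← mat_mul, inv_mul_cancel]; rfl
      calc mat w⁻¹ = mat w⁻¹ * (mat w * (levi A⁻¹ * unip (X * Bᵀ * Xᵀ) (-h * Xᵀ))) := by
            rw [h1, Matrix.mul_one]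
        _ = _ := by rw [← Matrix.mul_assoc, h5, Matrix.one_mul]
    refine ⟨A⁻¹, X * Bᵀ * Xᵀ, -h * Xᵀ, ?_, main⟩
    have e : X * Bᵀ * Xᵀ + (X * Bᵀ * Xᵀ)ᵀ + (-h * Xᵀ)ᵀ * (-h * Xᵀ) =
        X * (B + Bᵀ + hᵀ * h) * Xᵀ := by
      simp only [transpose_mul, transpose_transpose, transpose_neg, Matrix.mul_add,
        Matrix.add_mul, Matrix.mul_assoc, Matrix.neg_mul, Matrix.mul_neg, neg_neg]
      abel
    rw [e, hB]; simp

/-- An involutive matrix preserving `J`, as an element of `O(2n+1, F)`. -/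
def ofInvolution (M : Matrix (Idx n) (Idx n) F) (h1 : M * M = 1) (h2 : Mᵀ * J n F * M = J n F) :
    O n F :=
  ⟨⟨M, M, h1, h1⟩, h2⟩

/-- `ρ = diag(1_n, 1_n, -1)`. -/
def rho : O n F :=
  ofInvolution n F (block3 1 0 0 0 1 0 0 0 (-1))
    (by rw [block3_mul, ← block3_one]; congr 1 <;> simp)
    (by rw [J, block3_transpose, block3_mul, block3_mul]; congr 1 <;> simp)

/-- `diag(1_r, 0_{n-r})`, of size `n × n`. -/
def idem (r : ℕ) : Matrix (Fin n) (Fin n) F :=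
  diagonal fun i => if (i : ℕ) < r then 1 else 0

theorem idem_transpose (r : ℕ) : (idem n F r)ᵀ = idem n F r := by simp [idem]

theorem idem_mul_self (r : ℕ) : idem n F r * idem n F r = idem n F r := by simp [idem]

/-- The matrix `σ_r` (for `0 ≤ r ≤ n`), which exchanges the first `r` basis vectors of the first
block of size `n` with those of the second block and fixes all other basis vectors; in blocks of
sizes `r, n-r, r, n-r, 1` its rows are `0 0 1 0 0`, `0 1 0 0 0`, `1 0 0 0 0`, `0 0 0 1 0`,
`0 0 0 0 1`. -/
def sigma (r : ℕ) : O n F :=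
  ofInvolution n F
    (block3 (1 - idem n F r) (idem n F r) 0 (idem n F r) (1 - idem n F r) 0 0 0 1)
    (by
      rw [block3_mul, ← block3_one]
      congr 1 <;> simp [Matrix.mul_sub, Matrix.sub_mul, idem_mul_self])
    (by
      rw [J, block3_transpose, block3_mul, block3_mul]
      congr 1 <;> simp [Matrix.mul_sub, Matrix.sub_mul, idem_mul_self, idem_transpose])

/-- The double coset `Q σ_r Q`. -/
def QsQ (r : ℕ) : Set (O n F) := DoubleCoset.doubleCoset (sigma n F r) (Q n F) (Q n F)

/-- The set `ρ Q σ_r Q`. -/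
def rhoQsQ (r : ℕ) : Set (O n F) := (fun w => rho n F * w) '' QsQ n F r

/-- `DC₁⁻(n, F) = Q σ_{n-1} Q`, used for odd `n`. -/
def DC1minus : Set (O n F) := QsQ n F (n - 1)

/-- `DC₂⁻(n, F) = ρ Q σ_{n-1} Q`, used for odd `n`. -/
def DC2minus : Set (O n F) := rhoQsQ n F (n - 1)

/-- `DC₁⁺(n, F) = Q σ_{n-2} Q`, used for even `n ≥ 2`. -/
def DC1plus : Set (O n F) := QsQ n F (n - 2)

/-- `DC₂⁺(n, F) = ρ Q σ_{n-2} Q`, used for even `n ≥ 2`. -/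
def DC2plus : Set (O n F) := rhoQsQ n F (n - 2)

variable {n F}

/-- `N_S(β)`: the number of `w ∈ S` with trace `β`. -/
noncomputable def N (S : Set (O n F)) (β : F) : ℕ := {w ∈ S | (mat w).trace = β}.ncard

end OddOrthogonal

namespace OddOrthogonal

open Matrix

/-! ### Levi elements and positivity for rank at least two -/

section General

variable {n : ℕ} {F : Type*} [Field F]

/-! Positivity needs only one element of each trace. The product of `diag(A, ᵗA⁻¹, 1)` with `σ_r`
lies in `Q σ_r Q`, and its trace is 1 plus the sum of the last `n - r` diagonal entries of `A` and
of `A⁻¹`; multiplying by `ρ` turns the 1 into -1. If `A` is the identity with last block `0 1; -1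
t`, whose inverse is `t -1; 1 0`, that sum is `t` for `r = n - 1` and `2t` for `r = n - 2`, so every
value occurs once 2 is invertible.

For `n = 1` the double coset is `Q` itself. In characteristic 3 the relation on `B` and `h` forces
`B = h²`, so `Q` is parametrized by pairs `(a, h)` with trace `a + a⁻¹ + 1`. Each admissible `a`
thus counts `q` times, and the admissible `a` are found by completing the square in `a² - γa + 1 =
0`. -/

theorem levi_orthogonal (A : GL (Fin n) F) : (levi A)ᵀ * J n F * levi A = J n F := by
  have h1 : ((A⁻¹ : GL (Fin n) F) : Matrix (Fin n) (Fin n) F) * (A : Matrix (Fin n) (Fin n) F) =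
      1 := by rw [← Units.val_mul, inv_mul_cancel, Units.val_one]
  have h2 : (A : Matrix (Fin n) (Fin n) F)ᵀ *
      ((A⁻¹ : GL (Fin n) F) : Matrix (Fin n) (Fin n) F)ᵀ = 1 := by
    rw [← transpose_mul, h1, transpose_one]
  rw [J, levi, block3_transpose, block3_mul, block3_mul]
  congr 1 <;> simp [-coe_units_inv, h1, h2]

/-- The Levi element `diag(A, ᵗA⁻¹, 1)` of `O(2n+1, F)`. -/
def leviElt (A : GL (Fin n) F) : O n F :=
  ⟨⟨levi A, levi A⁻¹,
    by rw [levi_mul, mul_inv_cancel, levi, ← block3_one]; simp,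
    by rw [levi_mul, inv_mul_cancel, levi, ← block3_one]; simp⟩, levi_orthogonal A⟩

theorem unip_zero : unip (0 : Matrix (Fin n) (Fin n) F) 0 = 1 := by
  rw [unip, ← block3_one]; simp

theorem unip_orthogonal {B : Matrix (Fin n) (Fin n) F} {h : Matrix (Fin 1) (Fin n) F}
    (hB : B + Bᵀ + hᵀ * h = 0) : (unip B h)ᵀ * J n F * unip B h = J n F := by
  rw [J, unip, block3_transpose, block3_mul, block3_mul]
  congr 1 <;> simp [hB]

/-- The unipotent element of `O(2n+1, F)` attached to `B` and `h` with `B + ᵗB + ᵗh h = 0`. -/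
def unipElt (B : Matrix (Fin n) (Fin n) F) (h : Matrix (Fin 1) (Fin n) F)
    (hB : B + Bᵀ + hᵀ * h = 0) : O n F :=
  ⟨⟨unip B h, unip Bᵀ (-h),
    by rw [unip_mul, Matrix.mul_neg, sub_neg_eq_add, add_comm Bᵀ B, hB, add_neg_cancel, unip_zero],
    by rw [unip_mul, transpose_neg, Matrix.neg_mul, sub_neg_eq_add, hB, neg_add_cancel,
      unip_zero]⟩, unip_orthogonal hB⟩

theorem leviElt_mem_Q (A : GL (Fin n) F) : leviElt A ∈ Q n F :=
  ⟨A, 0, 0, by simp, by rw [unip_zero, Matrix.mul_one]; rfl⟩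

theorem trace_block3 (A B : Matrix (Fin n) (Fin n) F) (e : Matrix (Fin n) (Fin 1) F)
    (C D : Matrix (Fin n) (Fin n) F) (f : Matrix (Fin n) (Fin 1) F)
    (g h : Matrix (Fin 1) (Fin n) F) (i : Matrix (Fin 1) (Fin 1) F) :
    (block3 A B e C D f g h i).trace = A.trace + D.trace + i 0 0 := by
  simp [block3, trace, Fintype.sum_sum_type]

theorem leviElt_mul_sigma_mem (A : GL (Fin n) F) (r : ℕ) :
    leviElt A * sigma n F r ∈ QsQ n F r :=
  DoubleCoset.mem_doubleCoset.2 ⟨leviElt A, leviElt_mem_Q A, 1, one_mem _, by simp⟩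

theorem trace_leviElt_mul_sigma (A : GL (Fin n) F) (r : ℕ) :
    (mat (leviElt A * sigma n F r)).trace =
      ((A : Matrix (Fin n) (Fin n) F) * (1 - idem n F r)).trace +
        (((A⁻¹ : GL (Fin n) F) : Matrix (Fin n) (Fin n) F)ᵀ * (1 - idem n F r)).trace + 1 := by
  change (levi A * block3 (1 - idem n F r) (idem n F r) 0 (idem n F r)
    (1 - idem n F r) 0 0 0 1).trace = _
  rw [levi, block3_mul, trace_block3]
  simp [-coe_units_inv]

theorem trace_rho_mul_leviElt_mul_sigma (A : GL (Fin n) F) (r : ℕ) :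
    (mat (rho n F * (leviElt A * sigma n F r))).trace =
      ((A : Matrix (Fin n) (Fin n) F) * (1 - idem n F r)).trace +
        (((A⁻¹ : GL (Fin n) F) : Matrix (Fin n) (Fin n) F)ᵀ * (1 - idem n F r)).trace - 1 := by
  change (block3 1 0 0 0 1 0 0 0 (-1) * (levi A * block3 (1 - idem n F r) (idem n F r) 0
    (idem n F r) (1 - idem n F r) 0 0 0 1)).trace = _
  rw [levi, block3_mul, block3_mul, trace_block3]
  simp [-coe_units_inv, sub_eq_add_neg]

theorem trace_mul_one_sub_idem (X : Matrix (Fin n) (Fin n) F) (r : ℕ) :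
    (X * (1 - idem n F r)).trace = ∑ i : Fin n, if (i : ℕ) < r then 0 else X i i := by
  rw [idem, ← diagonal_one, diagonal_sub, trace]
  refine Finset.sum_congr rfl fun i _ => ?_
  rw [diag_apply, mul_diagonal]
  split_ifs <;> simp

/-- The matrix equal to the identity, except for the last `2 × 2` diagonal block, which is
`0 1`, `-1 t`. -/
def lastBlock (m : ℕ) (t : F) : GL (Fin (m + 2)) F :=
  ⟨reindex finSumFinEquiv finSumFinEquiv (fromBlocks 1 0 0 !![0, 1; -1, t]),
    reindex finSumFinEquiv finSumFinEquiv (fromBlocks 1 0 0 !![t, -1; 1, 0]),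
    by simp [submatrix_mul_equiv, fromBlocks_multiply, ← one_fin_two],
    by simp [submatrix_mul_equiv, fromBlocks_multiply, ← one_fin_two]⟩

/-- The block has diagonal `0, t`, so only the very last coordinate can contribute. -/
theorem trace_lastBlock (m : ℕ) (t : F) (r : ℕ) (hr : m ≤ r) :
    ((lastBlock m t : Matrix (Fin (m + 2)) (Fin (m + 2)) F) * (1 - idem (m + 2) F r)).trace =
      if m + 1 < r then 0 else t := by
  rw [trace_mul_one_sub_idem, Fin.sum_univ_add, Fin.sum_univ_two]
  rw [Finset.sum_eq_zero fun i _ => if_pos (by simp; omega)]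
  simp only [lastBlock, reindex_apply, submatrix_apply, finSumFinEquiv_symm_apply_natAdd,
    fromBlocks_apply₂₂]
  simp

/-- The inverse block has diagonal `t, 0`: here `t` sits one place earlier, hence survives only for
`r = m`. -/
theorem trace_lastBlock_inv (m : ℕ) (t : F) (r : ℕ) (hr : m ≤ r) :
    ((((lastBlock m t)⁻¹ : GL (Fin (m + 2)) F) : Matrix (Fin (m + 2)) (Fin (m + 2)) F)ᵀ *
      (1 - idem (m + 2) F r)).trace = if m < r then 0 else t := by
  rw [trace_mul_one_sub_idem, Fin.sum_univ_add, Fin.sum_univ_two]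
  rw [Finset.sum_eq_zero fun i _ => if_pos (by simp; omega)]
  simp only [lastBlock, Units.inv_mk, reindex_apply, submatrix_apply, transpose_apply,
    finSumFinEquiv_symm_apply_natAdd, fromBlocks_apply₂₂]
  simp

theorem N_pos [Finite F] {S : Set (O n F)} {β : F} {w : O n F} (hw : w ∈ S)
    (ht : (mat w).trace = β) : 0 < N S β := by
  -- Finiteness matters: `ncard` is 0 on infinite sets.
  have : Finite (O n F) := Finite.of_injective mat mat_injective
  exact (Set.ncard_pos (Set.toFinite _)).2 ⟨w, hw, ht⟩

theorem N_QsQ_pred_pos [Finite F] (hn : 2 ≤ n) (β : F) :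
    0 < N (QsQ n F (n - 1)) β ∧ 0 < N (rhoQsQ n F (n - 1)) β := by
  obtain ⟨m, rfl⟩ := Nat.exists_eq_add_of_le' hn
  constructor
  -- For `r = m + 1` the matrix contributes `t` and its inverse 0, so the trace is `t + 1`.
  · refine N_pos (leviElt_mul_sigma_mem (lastBlock m (β - 1)) _) ?_
    rw [trace_leviElt_mul_sigma, trace_lastBlock _ _ _ (by omega),
      trace_lastBlock_inv _ _ _ (by omega)]
    simp
  · refine N_pos (Set.mem_image_of_mem _ (leviElt_mul_sigma_mem (lastBlock m (β + 1)) _)) ?_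
    rw [trace_rho_mul_leviElt_mul_sigma, trace_lastBlock _ _ _ (by omega),
      trace_lastBlock_inv _ _ _ (by omega)]
    simp

theorem N_QsQ_pred_pred_pos [Finite F] (h2 : (2 : F) ≠ 0) (hn : 2 ≤ n) (β : F) :
    0 < N (QsQ n F (n - 2)) β ∧ 0 < N (rhoQsQ n F (n - 2)) β := by
  obtain ⟨m, rfl⟩ := Nat.exists_eq_add_of_le' hn
  constructor
  -- For `r = m` both the matrix and its inverse contribute `t`, so the trace is `2t + 1`.
  · refine N_pos (leviElt_mul_sigma_mem (lastBlock m ((β - 1) / 2)) _) ?_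
    rw [trace_leviElt_mul_sigma, trace_lastBlock _ _ _ (by omega),
      trace_lastBlock_inv _ _ _ (by omega)]
    simp only [add_tsub_cancel_right, lt_irrefl, if_false, not_lt.2 (Nat.le_succ m)]
    field_simp
    ring
  · refine N_pos (Set.mem_image_of_mem _ (leviElt_mul_sigma_mem (lastBlock m ((β + 1) / 2)) _)) ?_
    rw [trace_rho_mul_leviElt_mul_sigma, trace_lastBlock _ _ _ (by omega),
      trace_lastBlock_inv _ _ _ (by omega)]
    simp only [add_tsub_cancel_right, lt_irrefl, if_false, not_lt.2 (Nat.le_succ m)]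
    field_simp
    ring

end General

/-! ### Exact counts in rank one -/

section RankOne

variable {F : Type*} [Field F]

theorem QsQ_zero (n : ℕ) : QsQ n F 0 = (Q n F : Set (O n F)) := by
  have h : sigma n F 0 = 1 := by
    apply mat_injective
    change block3 (1 - idem n F 0) (idem n F 0) 0 (idem n F 0) (1 - idem n F 0) 0 0 0 1 = 1
    have : idem n F 0 = 0 := by simp [idem]
    rw [this, ← block3_one]; simp
  rw [QsQ, h]
  ext w
  rw [DoubleCoset.mem_doubleCoset]
  constructor
  · rintro ⟨x, hx, y, hy, rfl⟩
    simpa using mul_mem hx hy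
  · intro hw
    exact ⟨w, hw, 1, one_mem _, by simp⟩

/-- The `1 × 1` invertible matrix with entry `a`. -/
def glOne (a : Fˣ) : GL (Fin 1) F :=
  ⟨of fun _ _ => (a : F), of fun _ _ => ((a⁻¹ : Fˣ) : F),
    by ext i j; fin_cases i; fin_cases j; simp [Matrix.mul_apply],
    by ext i j; fin_cases i; fin_cases j; simp [Matrix.mul_apply]⟩

theorem exists_glOne_eq (A : GL (Fin 1) F) : ∃ a, glOne a = A := by
  refine ⟨A.det, Units.ext ?_⟩
  ext i j
  fin_cases i; fin_cases j
  simp [glOne]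

/-- The left side has entry `3h²`. -/
theorem sq_relation [CharP F 3] (h : F) :
    (of fun _ _ => h ^ 2 : Matrix (Fin 1) (Fin 1) F) + (of fun _ _ => h ^ 2)ᵀ +
      (of fun _ _ => h : Matrix (Fin 1) (Fin 1) F)ᵀ * (of fun _ _ => h) = 0 := by
  have h3 : (3 : F) = 0 := CharP.cast_eq_zero F 3
  ext i j
  simp [Matrix.mul_apply]
  linear_combination h ^ 2 * h3

/-- The parametrization of `Q(3, F)` by `Fˣ × F`, in characteristic three. -/
def paramQ [CharP F 3] (p : Fˣ × F) : O 1 F :=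
  leviElt (glOne p.1) * unipElt (of fun _ _ => p.2 ^ 2) (of fun _ _ => p.2) (sq_relation p.2)

theorem mat_paramQ [CharP F 3] (p : Fˣ × F) :
    mat (paramQ p) = levi (glOne p.1) * unip (of fun _ _ => p.2 ^ 2) (of fun _ _ => p.2) := rfl

theorem range_paramQ [CharP F 3] : Set.range (paramQ (F := F)) = Q 1 F := by
  have h3 : (3 : F) = 0 := CharP.cast_eq_zero F 3
  ext w
  constructor
  · rintro ⟨p, rfl⟩
    exact ⟨_, _, _, sq_relation p.2, mat_paramQ p⟩
  · rintro ⟨A, B, h, hB, hw⟩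
    obtain ⟨a, rfl⟩ := exists_glOne_eq A
    refine ⟨(a, h 0 0), mat_injective ?_⟩
    have hh : (of fun _ _ => h 0 0 : Matrix (Fin 1) (Fin 1) F) = h := by
      ext i j; fin_cases i; fin_cases j; rfl
    have hB' : (of fun _ _ => h 0 0 ^ 2 : Matrix (Fin 1) (Fin 1) F) = B := by
      ext i j; fin_cases i; fin_cases j
      have := congrFun (congrFun hB 0) 0
      simp [Matrix.mul_apply] at this
      simp
      -- From `2B + h² = 0`, subtracting `3B = 0` leaves `h² = B`.
      linear_combination this - B 0 0 * h3
    rw [mat_paramQ, hw, hh, hB']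

theorem paramQ_injective [CharP F 3] : Function.Injective (paramQ (F := F)) := by
  rintro ⟨a, x⟩ ⟨b, y⟩ hab
  have h := congrArg mat hab
  rw [mat_paramQ, mat_paramQ, levi, levi, unip, unip, block3_mul, block3_mul] at h
  -- The top left entry of the product is `a`, and the middle entry of its last row is `h`.
  have h1 := congrFun (congrFun h (.inl (.inl 0))) (.inl (.inl 0))
  have h2 := congrFun (congrFun h (.inr 0)) (.inl (.inr 0))
  simp [block3, glOne] at h1 h2
  exact Prod.ext (Units.ext h1) h2

theorem trace_paramQ [CharP F 3] (p : Fˣ × F) :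
    (mat (paramQ p)).trace = (p.1 : F) + ((p.1⁻¹ : Fˣ) : F) + 1 := by
  rw [mat_paramQ, levi, unip, block3_mul, trace_block3]
  simp [-coe_units_inv, glOne, Matrix.trace_fin_one]

theorem trace_rho_mul_paramQ [CharP F 3] (p : Fˣ × F) :
    (mat (rho 1 F * paramQ p)).trace = (p.1 : F) + ((p.1⁻¹ : Fˣ) : F) - 1 := by
  change (block3 1 0 0 0 1 0 0 0 (-1) * mat (paramQ p)).trace = _
  rw [mat_paramQ, levi, unip, block3_mul, block3_mul, trace_block3]
  simp [-coe_units_inv, glOne, Matrix.trace_fin_one, sub_eq_add_neg]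

/-- The number of `a ∈ Fˣ` with `a + a⁻¹ = γ`. -/
noncomputable def reciprocalSumCount (γ : F) : ℕ :=
  {a : Fˣ | (a : F) + ((a⁻¹ : Fˣ) : F) = γ}.ncard

/-- The trace does not involve `h`, whose free choice gives the factor `Nat.card F`. -/
theorem N_DC1minus_one [CharP F 3] (β : F) :
    N (DC1minus 1 F) β = reciprocalSumCount (β - 1) * Nat.card F := by
  rw [N, DC1minus, QsQ_zero, ← range_paramQ, reciprocalSumCount, ← Set.ncard_univ,
    ← Set.ncard_prod, ← Set.ncard_image_of_injective _ (paramQ_injective (F := F))]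
  congr 1
  ext w
  constructor
  · rintro ⟨⟨p, rfl⟩, hp⟩
    rw [trace_paramQ] at hp
    exact ⟨p, ⟨by rw [← hp]; simp, trivial⟩, rfl⟩
  · rintro ⟨p, ⟨hp, -⟩, rfl⟩
    refine ⟨⟨p, rfl⟩, ?_⟩
    rw [trace_paramQ, show (p.1 : F) + ((p.1⁻¹ : Fˣ) : F) = β - 1 from hp, sub_add_cancel]

theorem N_DC2minus_one [CharP F 3] (β : F) :
    N (DC2minus 1 F) β = reciprocalSumCount (β + 1) * Nat.card F := by
  rw [N, DC2minus, rhoQsQ, QsQ_zero, ← range_paramQ, reciprocalSumCount, ← Set.ncard_univ,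
    ← Set.ncard_prod, ← Set.ncard_image_of_injective _
      ((mul_right_injective (rho 1 F)).comp (paramQ_injective (F := F)))]
  congr 1
  ext w
  constructor
  · rintro ⟨⟨_, ⟨p, rfl⟩, rfl⟩, hp⟩
    rw [trace_rho_mul_paramQ] at hp
    exact ⟨p, ⟨by rw [← hp]; simp, trivial⟩, rfl⟩
  · rintro ⟨p, ⟨hp, -⟩, rfl⟩
    refine ⟨⟨_, ⟨p, rfl⟩, rfl⟩, ?_⟩
    rw [Function.comp_apply, trace_rho_mul_paramQ,
      show (p.1 : F) + ((p.1⁻¹ : Fˣ) : F) = β + 1 from hp, add_sub_cancel_right]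

/-- Multiplying by `a` gives `a² - γa + 1 = 0`; since `-γ = 2γ`, the square completes without
division. -/
theorem unit_add_inv_eq_iff [CharP F 3] (a : Fˣ) (γ : F) :
    (a : F) + ((a⁻¹ : Fˣ) : F) = γ ↔ ((a : F) + γ) ^ 2 = γ ^ 2 - 1 := by
  have h3 : (3 : F) = 0 := CharP.cast_eq_zero F 3
  have ha : (a : F) * ((a⁻¹ : Fˣ) : F) = 1 := by simp
  constructor
  · intro h
    linear_combination (a : F) * h - ha + (a : F) * γ * h3
  · intro h
    apply mul_left_cancel₀ a.ne_zero
    linear_combination h + ha - (a : F) * γ * h3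

/-- With `s² = γ² - 1`, the solutions are `±s - γ`. Their product is `γ² - s² = 1`, so they are
units inverse to each other; they differ because `2s ≠ 0`. -/
theorem reciprocalSumCount_eq_two [CharP F 3] {γ : F} (h0 : γ ^ 2 - 1 ≠ 0)
    (hs : IsSquare (γ ^ 2 - 1)) : reciprocalSumCount γ = 2 := by
  have h3 : (3 : F) = 0 := CharP.cast_eq_zero F 3
  obtain ⟨s, hs⟩ := hs
  have hs0 : s ≠ 0 := by rintro rfl; exact h0 (by simpa using hs)
  have e1 : (s - γ) * (-s - γ) = 1 := by linear_combination hs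
  refine Set.ncard_eq_two.2 ⟨⟨s - γ, -s - γ, e1, by rw [mul_comm, e1]⟩,
    ⟨-s - γ, s - γ, by rw [mul_comm, e1], e1⟩, ?_, ?_⟩
  · intro h
    have h := congrArg Units.val h
    simp only at h
    exact hs0 (by linear_combination s * h3 - h)
  · ext a
    simp only [Set.mem_ofPred_eq, Set.mem_insert_iff, Set.mem_singleton_iff, Units.ext_iff,
      unit_add_inv_eq_iff, hs, ← pow_two, sq_eq_sq_iff_eq_or_eq_neg, eq_sub_iff_add_eq]

theorem reciprocalSumCount_eq_one [CharP F 3] {γ : F} (h0 : γ ^ 2 - 1 = 0) :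
    reciprocalSumCount γ = 1 := by
  have e1 : (-γ) * (-γ) = 1 := by linear_combination h0
  refine Set.ncard_eq_one.2 ⟨⟨-γ, -γ, e1, e1⟩, ?_⟩
  ext a
  simp only [Set.mem_ofPred_eq, Set.mem_singleton_iff, Units.ext_iff, unit_add_inv_eq_iff, h0,
    sq_eq_zero_iff, eq_neg_iff_add_eq_zero]

theorem reciprocalSumCount_eq_zero [CharP F 3] {γ : F} (hs : ¬ IsSquare (γ ^ 2 - 1)) :
    reciprocalSumCount γ = 0 := by
  refine (congrArg Set.ncard (Set.eq_empty_of_forall_notMem fun a ha => hs ?_)).trans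
    (Set.ncard_empty _)
  rw [← (unit_add_inv_eq_iff a γ).1 ha, pow_two]
  exact ⟨_, rfl⟩

end RankOne

end OddOrthogonal

theorem corollary3p8 {F : Type*} [Field F] [Fintype F] (q r : ℕ) (hr : 0 < r) (hq : q = 3 ^ r)
    (hF : Fintype.card F = q) :
    ((∀ n : ℕ, Odd n → 3 ≤ n → ∀ β : F, 0 < OddOrthogonal.N (OddOrthogonal.DC1minus n F) β) ∧
      ∀ β : F,
        (β ^ 2 - 2 * β ≠ 0 → IsSquare (β ^ 2 - 2 * β) →
          OddOrthogonal.N (OddOrthogonal.DC1minus 1 F) β = 2 * q) ∧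
        ((β = 0 ∨ β = 2) → OddOrthogonal.N (OddOrthogonal.DC1minus 1 F) β = q) ∧
        (¬ IsSquare (β ^ 2 - 2 * β) → OddOrthogonal.N (OddOrthogonal.DC1minus 1 F) β = 0)) ∧
    ((∀ n : ℕ, Odd n → 3 ≤ n → ∀ β : F, 0 < OddOrthogonal.N (OddOrthogonal.DC2minus n F) β) ∧
      ∀ β : F,
        (β ^ 2 + 2 * β ≠ 0 → IsSquare (β ^ 2 + 2 * β) →
          OddOrthogonal.N (OddOrthogonal.DC2minus 1 F) β = 2 * q) ∧
        ((β = 0 ∨ β = 1) → OddOrthogonal.N (OddOrthogonal.DC2minus 1 F) β = q) ∧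
        (¬ IsSquare (β ^ 2 + 2 * β) → OddOrthogonal.N (OddOrthogonal.DC2minus 1 F) β = 0)) ∧
    (∀ n : ℕ, Even n → 2 ≤ n → ∀ β : F, 0 < OddOrthogonal.N (OddOrthogonal.DC1plus n F) β) ∧
    (∀ n : ℕ, Even n → 2 ≤ n → ∀ β : F, 0 < OddOrthogonal.N (OddOrthogonal.DC2plus n F) β) := by
  open OddOrthogonal in
  have hchar : CharP F 3 := by
    have : Fact (Nat.Prime 3) := ⟨Nat.prime_three⟩
    exact charP_of_card_eq_prime_pow (f := r) (by rw [hF, hq])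
  have h3 : (3 : F) = 0 := CharP.cast_eq_zero F 3
  have h2 : (2 : F) ≠ 0 := fun h => one_ne_zero (α := F) (by linear_combination h3 - h)
  have hcard : Nat.card F = q := by rw [Nat.card_eq_fintype_card, hF]
  -- Substituting `γ = β - 1` or `γ = β + 1` into `γ² - 1` yields the two quadratics in `β`.
  have e1 (β : F) : (β - 1) ^ 2 - 1 = β ^ 2 - 2 * β := by ring
  have e2 (β : F) : (β + 1) ^ 2 - 1 = β ^ 2 + 2 * β := by ring
  refine ⟨⟨fun n _ hn β => (N_QsQ_pred_pos (by omega) β).1, fun β => ⟨fun h0 hs => ?_,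
    fun h => ?_, fun hs => ?_⟩⟩, ⟨fun n _ hn β => (N_QsQ_pred_pos (by omega) β).2,
    fun β => ⟨fun h0 hs => ?_, fun h => ?_, fun hs => ?_⟩⟩,
    fun n _ hn β => (N_QsQ_pred_pred_pos h2 hn β).1,
    fun n _ hn β => (N_QsQ_pred_pred_pos h2 hn β).2⟩
  · rw [N_DC1minus_one, reciprocalSumCount_eq_two (by rwa [e1]) (by rwa [e1]), hcard]
  · rw [N_DC1minus_one, reciprocalSumCount_eq_one, hcard, one_mul]
    rcases h with rfl | rfl <;> ring
  · rw [N_DC1minus_one, reciprocalSumCount_eq_zero (by rwa [e1]), zero_mul]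
  · rw [N_DC2minus_one, reciprocalSumCount_eq_two (by rwa [e2]) (by rwa [e2]), hcard]
  · rw [N_DC2minus_one, reciprocalSumCount_eq_one, hcard, one_mul]
    rcases h with rfl | rfl
    · ring
    -- At `β = 1` the quantity `(β + 1)² - 1` equals 3, which vanishes.
    · linear_combination h3
  · rw [N_DC2minus_one, reciprocalSumCount_eq_zero (by rwa [e2]), zero_mul]
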